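/- Fix $0<p<1$, $0<q<1$ and $c\ge 0$. Consider the Markov decision process with states $S=(v,\lambda,b)$, where $v\in\{1,2,\dots\}$ is the age of the user, $\lambda\in\{0,1\}$ says whether a fresh packet is available and $b\in\{0,1\}$ whether a packet is in the buffer, and with actions $a\in\{0,1\}$ ($1$ = store, $0$ = do not store). From $S=(v,\lambda,b)$ under $a$ the next state is $(v',\lambda',b')$, where $\lambda'=1$ with probability $p$ and $\lambda'=0$ with probability $1-p$; independently of $\lambda'$, - if $\lambda=1$, then $v'=1$ with probability $q$ and $v'=v+1$ with probability $1-q$; - if $\lambda=0$ and $b=1$, then $v'=2$ with probability $q$ and $v'=v+1$ with probability $1-q$ (for $v=1$ both outcomes give $v'=2$); - if $\lambda=b=0$, then $v'=v+1$; and $b'=a$ if $\lambda=1$, $b'=0$ if $\lambda=0$. Write $P_a(S,S')$ for these transition probabilities. The stage cost is $C(S,a)=ac+\sum_{S'=(v',\lambda',b')}v'\,P_a(S,S')$. A causal policy $\pi$ chooses the action of each slot, possibly at random, on the basis of the current state and of all past states and actions; its average cost from the initial state $S_0$ is $$J_\pi(S_0)=\limsup_{T\to\infty}\frac1T\,\mathbb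 E_\pi\Big[\sum_{t=1}^{T}C(S^\pi(t),a^\pi(t))\;\Big|\;S^\pi(1)=S_0\Big].$$ Then there is a stationary deterministic policy $f:\{1,2,\dots\}\times\{0,1\}^2\to\{0,1\}$ of switching type which is optimal, that is, $J_f(S_0)\le J_\pi(S_0)$ for every initial state $S_0$ and every causal policy $\pi$. Here switching type means: if $f(S)=1$, then $f(S')=1$ for every $S'\ge S$ (component-wise). Moreover $f$ can be chosen to store only available packets ($f(v,0,b)=0$ for all $v,b$) and to be of threshold form in the age alone: if $f(v,1,b)=1$ for some $b$, then $f(v',1,b')=1$ for all $v'\ge v$ and all $b'\in\{0,1\}$. -/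

import Mathlib

open Filter
open scoped ENNReal

namespace AgeStorage

noncomputable section

/-- A state `(v, l, b)`: the age `v ≥ 1` of the user, whether a fresh packet is available at the
base station (`l`), whether a packet is present in the buffer (`b`). The order on this type is the
component-wise one, with `false < true`. -/
abbrev State := ℕ+ × Bool × Bool

/-- The actions: `true` = store, `false` = do not store. -/
abbrev Action := Bool

/-- A coin that shows `true` with probability `r`. -/
def coin (r : unitInterval) : PMF Bool :=
  PMF.ofFintype (fun x => ENNReal.ofReal (if x then (r : ℝ) else 1 - (r : ℝ))) (by
    have h0 : (0 : ℝ) ≤ r := r.2.1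
    have h1 : (0 : ℝ) ≤ 1 - (r : ℝ) := sub_nonneg.2 r.2.2
    rw [Fintype.sum_bool, if_pos rfl, if_neg Bool.false_ne_true, ← ENNReal.ofReal_add h0 h1]
    simp)

/-- The age in the next slot, if the transmission over the channel succeeds (`ok = true`) or fails.
A fresh packet is transmitted if there is one, otherwise the buffered packet, if there is one. -/
def nextAge (ok : Bool) : State → ℕ+
  | (v, l, b) => if ok && l then 1 else if ok && b then 2 else v + 1

/-- The transition law `P_a(S, ·)`: the channel is a `q`-coin, the next arrival an independent
`p`-coin, and the next buffer is full iff a fresh packet was available and was stored. -/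
def trans (p q : unitInterval) (a : Action) (S : State) : PMF State :=
  (coin q).bind fun ok => (coin p).map fun l' => (nextAge ok S, l', S.2.1 && a)

/-- The transition probabilities written out. (For `v = 1`, the two age events in the line with
`v' = 2` coincide and their probabilities add up.) -/
theorem trans_apply (p q : unitInterval) (a : Action) (v v' : ℕ+) (l b l' b' : Bool) :
    trans p q a (v, l, b) (v', l', b') =
      ENNReal.ofReal (if l' then (p : ℝ) else 1 - p) * (if b' = (l && a) then 1 else 0) *
      (if l then
        (if v' = 1 then ENNReal.ofReal q else 0) + (if v' = v + 1 then ENNReal.ofReal (1 - q) else 0)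
      else if b then
        (if v' = 2 then ENNReal.ofReal q else 0) + (if v' = v + 1 then ENNReal.ofReal (1 - q) else 0)
      else if v' = v + 1 then 1 else 0) := by
  cases l <;> cases b <;> cases l' <;> cases b' <;> cases a <;>
    simp [trans, coin, nextAge, PMF.bind_apply, PMF.map_apply, tsum_fintype, Prod.ext_iff] <;>
    (try split_ifs) <;> simp [mul_comm, mul_add]

/-- The stage cost `C(S, a) = a c + ∑_{S'} v' P_a(S, S')`. -/
def cost (p q : unitInterval) (c : ℝ) (S : State) (a : Action) : ℝ≥0∞ :=
  (if a then ENNReal.ofReal c else 0) + ∑' S' : State, trans p q a S S' * ((S'.1 : ℕ) : ℝ≥0∞)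

/-- The past: the state-action pairs of all earlier slots, the most recent one first. -/
abbrev Past := List (State × Action)

/-- A causal policy, possibly randomized: from the past and the current state, the law of the
current action. (The time is the length of the past.) -/
abbrev Policy := Past → State → PMF Action

/-- The stationary deterministic policy that uses the action `f S` in the state `S`. -/
def stationary (f : State → Action) : Policy := fun _ S => PMF.pure (f S)

/-- The joint law, under the policy `π` and the initial state `S₀`, of the state-action pairs of
the first `T` slots and of the state of the slot after them. -/
def law (p q : unitInterval) (π : Policy) (S₀ : State) : ℕ → PMF (Past × State)
  | 0 => PMF.pure ([], S₀)
  | T + 1 => (law p q π S₀ T).bind fun x =>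
      (π x.1 x.2).bind fun a => (trans p q a x.2).map fun S' => ((x.2, a) :: x.1, S')

/-- The total cost of the state-action pairs in a list. -/
def totalCost (p q : unitInterval) (c : ℝ) (h : Past) : ℝ≥0∞ :=
  (h.map fun y => cost p q c y.1 y.2).sum

/-- The expected total cost of the first `T` slots. -/
def expectedCost (p q : unitInterval) (c : ℝ) (π : Policy) (S₀ : State) (T : ℕ) : ℝ≥0∞ :=
  ∑' x : Past × State, law p q π S₀ T x * totalCost p q c x.1

/-- The long-run average cost: the limsup of the expected total cost of `T` slots over `T`. -/
def avgCost (p q : unitInterval) (c : ℝ) (π : Policy) (S₀ : State) : ℝ≥0∞ :=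
  limsup (fun T : ℕ => expectedCost p q c π S₀ T / (T : ℝ≥0∞)) atTop

/-- `π` is average-cost optimal: from every initial state it does at least as well as any causal
policy. -/
def IsOptimal (p q : unitInterval) (c : ℝ) (π : Policy) : Prop :=
  ∀ (S₀ : State) (π' : Policy), avgCost p q c π S₀ ≤ avgCost p q c π' S₀

/-- Switch-based: a policy that stores in `S` stores in every `S'` with `S' ≥ S`
component-wise. -/
def IsSwitching (f : State → Action) : Prop :=
  ∀ S S' : State, S ≤ S' → f S = true → f S' = true

/-- Threshold form in the age alone: a policy that stores an available packet at age `v` stores an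
available packet at every age `v' ≥ v`, whatever the buffer contains. -/
def IsAgeThreshold (f : State → Action) : Prop :=
  ∀ (v v' : ℕ+) (b b' : Bool), v ≤ v' → f (v, true, b) = true → f (v', true, b') = true

/-- The policy stores only if there is a packet to store. -/
def StoresOnlyAvailable (f : State → Action) : Prop :=
  ∀ (v : ℕ+) (b : Bool), f (v, false, b) = false

end

end AgeStorage

/-! Optimality follows from an explicit solution of the average-cost optimality equation. Let `X v`
be the expected relative value, less the gain `g`, of entering age `v` with an empty buffer (age
cost `v` included), before the next arrival is revealed. A fresh packet overrides the buffer, so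
storing matters only if the current transmission fails, no packet arrives next and the buffered
packet then gets through. This has probability `r = q(1-q)(1-p)` and replaces age `v+2` by `2`.
Normalised by `X 2 = 0`, the gain from storing is `r * X (v+2)`, independent of the buffer. Storing
is thus optimal iff `c ≤ r * X (v+2)`, a threshold in `v` once `X` is monotone.

Substitution leaves a second-order scalar recursion for `X`, solved in `exists_relative_value` by
shooting backwards from an affine tail; the increments stay in an invariant interval of positive
numbers, which gives monotonicity and linear growth. `isOptimal_of_optimality_equation` turns the
solution into optimality, the terminal term being controlled by a Lyapunov function for the age. -/

namespace AgeStorage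

/-! ### Expectations in `ℝ≥0∞` and their real counterparts. -/

/-- The expectation of an extended nonnegative function. -/
noncomputable def expect {α : Type*} (μ : PMF α) (F : α → ℝ≥0∞) : ℝ≥0∞ := ∑' x, μ x * F x

theorem expect_pure {α : Type*} (a : α) (F : α → ℝ≥0∞) : expect (PMF.pure a) F = F a := by
  classical
  rw [expect, tsum_eq_single a (by intro b hb; simp [PMF.pure_apply, hb])]
  simp

theorem expect_bind {α β : Type*} (μ : PMF α) (ν : α → PMF β) (F : β → ℝ≥0∞) :
    expect (μ.bind ν) F = expect μ fun x => expect (ν x) F := by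
  simp only [expect, PMF.bind_apply, ← ENNReal.tsum_mul_left, ← ENNReal.tsum_mul_right]
  rw [ENNReal.tsum_comm]
  simp only [mul_assoc]

theorem expect_map {α β : Type*} (μ : PMF α) (i : α → β) (F : β → ℝ≥0∞) :
    expect (μ.map i) F = expect μ fun x => F (i x) := by
  simp [PMF.map, expect_bind, expect_pure, Function.comp_def]

theorem expect_const {α : Type*} (μ : PMF α) (c : ℝ≥0∞) : expect μ (fun _ => c) = c := by
  simp [expect, ENNReal.tsum_mul_right, μ.tsum_coe]

theorem expect_add {α : Type*} (μ : PMF α) (F G : α → ℝ≥0∞) :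
    expect μ (fun x => F x + G x) = expect μ F + expect μ G := by
  simp [expect, mul_add, ENNReal.tsum_add]

theorem expect_const_mul {α : Type*} (μ : PMF α) (c : ℝ≥0∞) (F : α → ℝ≥0∞) :
    expect μ (fun x => c * F x) = c * expect μ F := by
  simp only [expect, ← ENNReal.tsum_mul_left]
  exact tsum_congr fun _ => by ring

theorem expect_mono {α : Type*} (μ : PMF α) {F G : α → ℝ≥0∞} (h : ∀ x, F x ≤ G x) :
    expect μ F ≤ expect μ G :=
  ENNReal.tsum_le_tsum fun x => by gcongr; exact h x

/-- The real-valued expectation of `F` after one transition. -/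
def step (p q : ℝ) (a : Action) (S : State) (F : State → ℝ) : ℝ :=
  q * (p * F (nextAge true S, true, S.2.1 && a) + (1 - p) * F (nextAge true S, false, S.2.1 && a)) +
  (1 - q) * (p * F (nextAge false S, true, S.2.1 && a) +
    (1 - p) * F (nextAge false S, false, S.2.1 && a))

theorem expect_coin (r : unitInterval) (F : Bool → ℝ≥0∞) :
    expect (coin r) F = ENNReal.ofReal r * F true + ENNReal.ofReal (1 - r) * F false := by
  simp [expect, coin, tsum_fintype]

theorem expect_trans (p q : unitInterval) (a : Action) (S : State) {F : State → ℝ}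
    (hF : ∀ S, 0 ≤ F S) :
    expect (trans p q a S) (fun S' => ENNReal.ofReal (F S')) =
      ENNReal.ofReal (step p q a S F) := by
  have hp := p.2.1
  have hq := q.2.1
  have hp1 : (0 : ℝ) ≤ 1 - p := sub_nonneg.2 p.2.2
  have hq1 : (0 : ℝ) ≤ 1 - q := sub_nonneg.2 q.2.2
  simp only [trans, expect_bind, expect_map, expect_coin, step]
  have key : ∀ x y : ℝ, 0 ≤ x → 0 ≤ y → ENNReal.ofReal p * ENNReal.ofReal x +
      ENNReal.ofReal (1 - p) * ENNReal.ofReal y = ENNReal.ofReal (p * x + (1 - p) * y) := by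
    intro x y hx hy
    rw [ENNReal.ofReal_add (mul_nonneg hp hx) (mul_nonneg hp1 hy), ENNReal.ofReal_mul hp,
      ENNReal.ofReal_mul hp1]
  have key0 : ∀ x y : ℝ, 0 ≤ x → 0 ≤ y → 0 ≤ p * x + (1 - p) * y := fun x y hx hy =>
    add_nonneg (mul_nonneg hp hx) (mul_nonneg hp1 hy)
  rw [key _ _ (hF _) (hF _), key _ _ (hF _) (hF _), ENNReal.ofReal_add
    (mul_nonneg hq (key0 _ _ (hF _) (hF _))) (mul_nonneg hq1 (key0 _ _ (hF _) (hF _))),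
    ENNReal.ofReal_mul hq, ENNReal.ofReal_mul hq1]

theorem step_nonneg (p q : unitInterval) (a : Action) (S : State) {F : State → ℝ}
    (hF : ∀ S, 0 ≤ F S) : 0 ≤ step p q a S F := by
  have hp := p.2.1
  have hq := q.2.1
  have hp1 : (0 : ℝ) ≤ 1 - p := sub_nonneg.2 p.2.2
  have hq1 : (0 : ℝ) ≤ 1 - q := sub_nonneg.2 q.2.2
  have key0 : ∀ x y : ℝ, 0 ≤ x → 0 ≤ y → 0 ≤ p * x + (1 - p) * y := fun x y hx hy =>
    add_nonneg (mul_nonneg hp hx) (mul_nonneg hp1 hy)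
  exact add_nonneg (mul_nonneg hq (key0 _ _ (hF _) (hF _)))
    (mul_nonneg hq1 (key0 _ _ (hF _) (hF _)))

/-- The stage cost as a real number. -/
def stageCost (p q c : ℝ) (S : State) (a : Action) : ℝ :=
  (if a then c else 0) + step p q a S fun S' => ((S'.1 : ℕ) : ℝ)

theorem cost_eq (p q : unitInterval) {c : ℝ} (hc : 0 ≤ c) (S : State) (a : Action) :
    cost p q c S a = ENNReal.ofReal (stageCost p q c S a) := by
  have h0 : ∀ S' : State, (0 : ℝ) ≤ ((S'.1 : ℕ) : ℝ) := fun _ => Nat.cast_nonneg _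
  have h := expect_trans p q a S h0
  simp only [expect, ENNReal.ofReal_natCast] at h
  rw [cost, h, stageCost, ENNReal.ofReal_add (by cases a <;> simp [hc]) (step_nonneg p q a S h0)]
  cases a <;> simp

theorem expectedCost_eq (p q : unitInterval) (c : ℝ) (π : Policy) (S₀ : State) (T : ℕ) :
    expectedCost p q c π S₀ T = expect (law p q π S₀ T) fun x => totalCost p q c x.1 := rfl

theorem expect_law_succ (p q : unitInterval) (π : Policy) (S₀ : State) (T : ℕ)
    (F : Past × State → ℝ≥0∞) :
    expect (law p q π S₀ (T + 1)) F = expect (law p q π S₀ T) fun x => expect (π x.1 x.2) fun a =>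
      expect (trans p q a x.2) fun S' => F ((x.2, a) :: x.1, S') := by
  simp only [law, expect_bind, expect_map]

theorem totalCost_cons (p q : unitInterval) (c : ℝ) (y : State × Action) (h : Past) :
    totalCost p q c (y :: h) = cost p q c y.1 y.2 + totalCost p q c h := by
  simp [totalCost]

theorem expect_totalCost_succ (p q : unitInterval) (c : ℝ) (π : Policy) (S₀ : State) (T : ℕ)
    (H : State → ℝ≥0∞) :
    expect (law p q π S₀ (T + 1)) (fun x => totalCost p q c x.1 + H x.2) =
      expect (law p q π S₀ T) fun x => totalCost p q c x.1 +
        expect (π x.1 x.2) fun a => cost p q c x.2 a + expect (trans p q a x.2) H := by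
  rw [expect_law_succ]
  congr 1
  funext x
  rw [← expect_const (π x.1 x.2) (totalCost p q c x.1), ← expect_add]
  congr 1
  funext a
  simp only [expect_add, expect_const, totalCost_cons]
  ring

/-! ### Cost bounds from the optimality inequalities. -/

section Verification

variable {p q : unitInterval} {c : ℝ} {H : State → ℝ≥0∞} {g : ℝ≥0∞}

/-- Accumulated cost plus `H` of the current state rises by at least `g` per slot in expectation,
whatever action is drawn. The terminal term stays on the right because subtraction in `ℝ≥0∞`
truncates. -/
theorem le_expectedCost_add (hH : ∀ S a, g + H S ≤ cost p q c S a + expect (trans p q a S) H)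
    (π : Policy) (S₀ : State) (T : ℕ) :
    T * g ≤ expectedCost p q c π S₀ T + expect (law p q π S₀ T) fun x => H x.2 := by
  rw [expectedCost_eq, ← expect_add]
  induction T with
  | zero => simp
  | succ T ih =>
    rw [expect_totalCost_succ]
    calc ((T + 1 : ℕ) : ℝ≥0∞) * g = T * g + g := by push_cast; ring
      _ ≤ expect (law p q π S₀ T) (fun x => totalCost p q c x.1 + H x.2) + g := by gcongr
      _ = expect (law p q π S₀ T) (fun x => totalCost p q c x.1 + (g + H x.2)) := by
        conv_lhs => rw [← expect_const (law p q π S₀ T) g, ← expect_add]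
        congr 1
        funext x
        ring
      _ ≤ _ := by
        refine expect_mono _ fun x => ?_
        gcongr
        rw [← expect_const (π x.1 x.2) (g + H x.2)]
        exact expect_mono _ fun a => hH x.2 a

theorem expectedCost_stationary_le {f : State → Action}
    (hH : ∀ S, cost p q c S (f S) + expect (trans p q (f S) S) H ≤ g + H S)
    (S₀ : State) (T : ℕ) : expectedCost p q c (stationary f) S₀ T ≤ T * g + H S₀ := by
  suffices expect (law p q (stationary f) S₀ T) (fun x => totalCost p q c x.1 + H x.2) ≤
      T * g + H S₀ by
    refine le_trans ?_ this
    exact expect_mono _ fun x => le_self_add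
  induction T with
  | zero => simp [law, expect_pure, totalCost]
  | succ T ih =>
    rw [expect_totalCost_succ]
    calc _ ≤ expect (law p q (stationary f) S₀ T) (fun x => totalCost p q c x.1 + H x.2 + g) := by
          refine expect_mono _ fun x => ?_
          rw [stationary, expect_pure, add_assoc, add_comm (H x.2)]
          exact add_le_add_right (hH x.2) _
      _ = expect (law p q (stationary f) S₀ T) (fun x => totalCost p q c x.1 + H x.2) + g := by
        rw [expect_add (law p q (stationary f) S₀ T) (fun x => totalCost p q c x.1 + H x.2) fun _ => g,
          expect_const]
      _ ≤ T * g + H S₀ + g := by gcongr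
      _ = _ := by push_cast; ring

end Verification

/-! ### Uniform bound on the expected age, and the verification theorem. -/

/-- A Lyapunov function for the age: the age, discounted if a fresh packet is available. -/
def ageWeight (q : ℝ) (S : State) : ℝ := ((S.1 : ℕ) : ℝ) * if S.2.1 then 1 - q else 1

theorem ageWeight_nonneg (q : unitInterval) (S : State) : 0 ≤ ageWeight q S := by
  have : (0 : ℝ) ≤ 1 - q := sub_nonneg.2 q.2.2
  unfold ageWeight
  split_ifs <;> positivity

/-- The expected next age is at most `ageWeight q S + 1`, and the independent next arrival
contributes the factor `p(1-q) + (1-p) = 1 - pq`. -/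
theorem step_ageWeight_le (p q : unitInterval) (a : Action) (S : State) :
    step p q a S (ageWeight q) ≤ (1 - p * q) * (ageWeight q S + 1) := by
  obtain ⟨v, l, b⟩ := S
  have hp := p.2.1
  have hq := q.2.1
  have hp1 : (p : ℝ) ≤ 1 := p.2.2
  have hq1 : (q : ℝ) ≤ 1 := q.2.2
  have hz : (0 : ℝ) ≤ 1 - p * q := by nlinarith
  have hv : (1 : ℝ) ≤ ((v : ℕ) : ℝ) := by exact_mod_cast v.2
  have hnn := mul_nonneg hq (sub_nonneg.2 hv)
  cases l <;> cases b <;> simp [step, ageWeight, nextAge] <;> nlinarith [mul_nonneg hz hnn]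

theorem expect_ageWeight_le (p q : unitInterval) (hp : 0 < p) (hq : 0 < q) (π : Policy)
    (S₀ : State) (T : ℕ) :
    expect (law p q π S₀ T) (fun x => ENNReal.ofReal (ageWeight q x.2)) ≤
      ENNReal.ofReal (ageWeight q S₀ + 1 / (p * q)) := by
  have hp' : (0 : ℝ) < p := hp
  have hq' : (0 : ℝ) < q := hq
  have hp1 : (p : ℝ) ≤ 1 := p.2.2
  have hq1 : (q : ℝ) ≤ 1 := q.2.2
  have hz : (0 : ℝ) ≤ 1 - p * q := by nlinarith
  have hw := ageWeight_nonneg q S₀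
  induction T with
  | zero =>
    simp only [law, expect_pure]
    exact ENNReal.ofReal_le_ofReal (le_add_of_nonneg_right (by positivity))
  | succ T ih =>
    rw [expect_law_succ]
    calc _ ≤ expect (law p q π S₀ T) (fun x => ENNReal.ofReal (1 - p * q) *
            (ENNReal.ofReal (ageWeight q x.2) + 1)) := by
          refine expect_mono _ fun x => ?_
          rw [← expect_const (π x.1 x.2) (ENNReal.ofReal (1 - p * q) *
            (ENNReal.ofReal (ageWeight q x.2) + 1))]
          refine expect_mono _ fun a => ?_
          rw [expect_trans p q a x.2 (ageWeight_nonneg q), ← ENNReal.ofReal_one,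
            ← ENNReal.ofReal_add (ageWeight_nonneg q _) zero_le_one, ← ENNReal.ofReal_mul hz]
          exact ENNReal.ofReal_le_ofReal (step_ageWeight_le p q a x.2)
      _ ≤ ENNReal.ofReal (1 - p * q) * (ENNReal.ofReal (ageWeight q S₀ + 1 / (p * q)) + 1) := by
          rw [expect_const_mul, expect_add, expect_const]
          gcongr
      _ ≤ _ := by
          rw [← ENNReal.ofReal_one, ← ENNReal.ofReal_add (by positivity) zero_le_one,
            ← ENNReal.ofReal_mul hz]
          apply ENNReal.ofReal_le_ofReal
          have h1 : (p * q : ℝ) * (1 / (p * q)) = 1 := mul_div_cancel₀ _ (by positivity)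
          have : 0 ≤ (p * q : ℝ) * ageWeight q S₀ := by positivity
          nlinarith

/-- A solution of the average-cost optimality equation of at most linear growth certifies the
optimality of the policies that attain the minimum. -/
theorem isOptimal_of_optimality_equation (p q : unitInterval) (hp : 0 < p) (hq : 0 < q)
    (hq1 : q < 1) {c : ℝ} (hc : 0 ≤ c) (f : State → Action) (h : State → ℝ) (g B : ℝ)
    (hg : 0 ≤ g) (hB : 0 ≤ B) (h0 : ∀ S, 0 ≤ h S) (hle : ∀ S, h S ≤ B * ((S.1 : ℕ) : ℝ))
    (hmin : ∀ S a, g + h S ≤ stageCost p q c S a + step p q a S h)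
    (hatt : ∀ S, stageCost p q c S (f S) + step p q (f S) S h = g + h S) :
    IsOptimal p q c (stationary f) := by
  have hq1' : (0 : ℝ) < 1 - q := sub_pos.2 hq1
  have hsc : ∀ S a, 0 ≤ stageCost p q c S a := fun S a =>
    add_nonneg (by cases a <;> simp [hc]) (step_nonneg p q a S fun _ => Nat.cast_nonneg _)
  have hsum : ∀ S a, cost p q c S a + expect (trans p q a S) (fun S' => ENNReal.ofReal (h S')) =
      ENNReal.ofReal (stageCost p q c S a + step p q a S h) := fun S a => by
    rw [cost_eq p q hc, expect_trans p q a S h0,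
      ENNReal.ofReal_add (hsc S a) (step_nonneg p q a S h0)]
  intro S₀ π
  have hup : avgCost p q c (stationary f) S₀ ≤ ENNReal.ofReal g := by
    have ht : Tendsto (fun T : ℕ => ENNReal.ofReal g + ENNReal.ofReal (h S₀) / (T : ℝ≥0∞)) atTop
        (nhds (ENNReal.ofReal g + 0)) :=
      tendsto_const_nhds.add
        (ENNReal.Tendsto.const_div ENNReal.tendsto_nat_nhds_top (Or.inr ENNReal.ofReal_ne_top)
          |>.trans (by simp))
    rw [← add_zero (ENNReal.ofReal g), ← ht.limsup_eq]
    refine limsup_le_limsup ?_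
    filter_upwards [eventually_gt_atTop 0] with T hT
    have hT0 : (T : ℝ≥0∞) ≠ 0 := by exact_mod_cast hT.ne'
    have := expectedCost_stationary_le (p := p) (q := q) (c := c) (g := ENNReal.ofReal g)
      (H := fun S => ENNReal.ofReal (h S)) (f := f)
      (fun S => by rw [hsum, hatt, ENNReal.ofReal_add hg (h0 S)]) S₀ T
    calc _ ≤ (T * ENNReal.ofReal g + ENNReal.ofReal (h S₀)) / (T : ℝ≥0∞) := by gcongr
      _ = _ := by
        rw [ENNReal.add_div, mul_comm, ENNReal.mul_div_cancel_right hT0 (ENNReal.natCast_ne_top T)]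
  refine hup.trans ?_
  set M : ℝ≥0∞ := ENNReal.ofReal (B / (1 - q)) *
    ENNReal.ofReal (ageWeight q S₀ + 1 / (p * q)) with hM
  have hMtop : M ≠ ⊤ := ENNReal.mul_ne_top ENNReal.ofReal_ne_top ENNReal.ofReal_ne_top
  -- The terminal term is bounded uniformly in `T`, so it disappears after division by `T`; `q < 1`
  -- is what lets `ageWeight` dominate the age.
  have hterm : ∀ T, expect (law p q π S₀ T) (fun x => ENNReal.ofReal (h x.2)) ≤ M := by
    intro T
    refine le_trans (expect_mono _ (G := fun x => ENNReal.ofReal (B / (1 - q)) *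
      ENNReal.ofReal (ageWeight q x.2)) fun x => ?_) ?_
    · rw [← ENNReal.ofReal_mul (by positivity)]
      apply ENNReal.ofReal_le_ofReal
      refine (hle x.2).trans ?_
      have hv : (0 : ℝ) ≤ ((x.2.1 : ℕ) : ℝ) := Nat.cast_nonneg _
      have hw : (1 - q : ℝ) * ((x.2.1 : ℕ) : ℝ) ≤ ageWeight q x.2 := by
        have := q.2.1
        unfold ageWeight
        split_ifs <;> nlinarith
      rw [div_mul_eq_mul_div, le_div_iff₀ hq1']
      nlinarith
    · rw [expect_const_mul]
      exact mul_le_mul_right (expect_ageWeight_le p q hp hq π S₀ T) _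
  have hM0 : Tendsto (fun T : ℕ => M / (T : ℝ≥0∞)) atTop (nhds 0) := by
    simpa using ENNReal.Tendsto.const_div (a := M) ENNReal.tendsto_nat_nhds_top (Or.inr hMtop)
  have hlow : ∀ᶠ T : ℕ in atTop, ENNReal.ofReal g ≤
      expectedCost p q c π S₀ T / (T : ℝ≥0∞) + M / (T : ℝ≥0∞) := by
    filter_upwards [eventually_gt_atTop 0] with T hT
    have hT0 : (T : ℝ≥0∞) ≠ 0 := by exact_mod_cast hT.ne'
    have := le_expectedCost_add (p := p) (q := q) (c := c) (g := ENNReal.ofReal g)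
      (H := fun S => ENNReal.ofReal (h S))
      (fun S a => by
        rw [hsum, ← ENNReal.ofReal_add hg (h0 S)]
        exact ENNReal.ofReal_le_ofReal (hmin S a)) π S₀ T
    rw [← ENNReal.add_div, ENNReal.le_div_iff_mul_le (Or.inl hT0)
      (Or.inl (ENNReal.natCast_ne_top T)), mul_comm]
    exact this.trans (by gcongr; exact hterm T)
  calc ENNReal.ofReal g = limsup (fun _ : ℕ => ENNReal.ofReal g) atTop := (limsup_const _).symm
    _ ≤ limsup (fun T : ℕ => expectedCost p q c π S₀ T / (T : ℝ≥0∞) + M / (T : ℝ≥0∞)) atTop :=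
      limsup_le_limsup hlow
    _ = avgCost p q c π S₀ := ENNReal.limsup_add_of_right_tendsto_zero hM0 _

/-! ### Solving the scalar recursion by backward shooting. -/

/-- The backward recursion `y (j + 2) = (n - 1 - j) - k + (1 - δ) y (j + 1) - max 0 (s (y j) - κ)`
started from a linear tail of slope `1 / (δ + s)` that takes the value `A` at `n`. -/
noncomputable def shoot (δ s κ n A : ℝ) : ℕ → ℝ
  | 0 => A + 1 / (δ + s)
  | 1 => A
  | j + 2 => (n - 1 - j) - (n + κ - (δ + s) * A + (1 - δ - 2 * s) * (1 / (δ + s)))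
      + (1 - δ) * shoot δ s κ n A (j + 1) - max 0 (s * shoot δ s κ n A j - κ)

theorem shoot_add_two (δ s κ n A : ℝ) (j : ℕ) : shoot δ s κ n A (j + 2) =
    (n - 1 - j) - (n + κ - (δ + s) * A + (1 - δ - 2 * s) * (1 / (δ + s)))
      + (1 - δ) * shoot δ s κ n A (j + 1) - max 0 (s * shoot δ s κ n A j - κ) := rfl

theorem continuous_shoot (δ s κ n : ℝ) : ∀ j, Continuous fun A => shoot δ s κ n A j
  | 0 => by simp only [shoot]; fun_prop
  | 1 => by simp only [shoot]; fun_prop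
  | j + 2 => by
    have h0 := continuous_shoot δ s κ n j
    have h1 := continuous_shoot δ s κ n (j + 1)
    simp only [shoot]
    fun_prop

theorem posPart_affine_sub_bounds {s κ x y : ℝ} (hs : 0 ≤ s) (h : y ≤ x) :
    0 ≤ max 0 (s * x - κ) - max 0 (s * y - κ) ∧
      max 0 (s * x - κ) - max 0 (s * y - κ) ≤ s * (x - y) := by
  have := mul_le_mul_of_nonneg_left h hs
  constructor
  · have : max 0 (s * y - κ) ≤ max 0 (s * x - κ) := max_le_max le_rfl (by linarith)
    linarith
  · rcases max_cases 0 (s * x - κ) with h1 | h1 <;> rcases max_cases 0 (s * y - κ) with h2 | h2 <;>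
      rw [h1.1, h2.1] <;> nlinarith

theorem tail_slope_bounds {δ s : ℝ} (hs : 0 < s) (hsd : s < δ) :
    (1 - s / δ) / δ ≤ 1 / (δ + s) ∧ 1 / (δ + s) ≤ 1 / δ := by
  have hδ : 0 < δ := hs.trans hsd
  constructor
  · rw [div_le_div_iff₀ hδ (by linarith)]
    have : s / δ * δ = s := div_mul_cancel₀ _ hδ.ne'
    have : 0 < s / δ := by positivity
    nlinarith
  · exact one_div_le_one_div_of_le hδ (by linarith)

/-- The interval is invariant because its endpoints are the fixed points of `d ↦ 1 + (1 - δ) d - t`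
for the extreme values `t = s / δ` and `t = 0`. -/
theorem increment_bounds {δ s d e t : ℝ} (hs : 0 < s) (hsd : s < δ) (hδ1 : δ < 1)
    (hd : (1 - s / δ) / δ ≤ d ∧ d ≤ 1 / δ) (he : e ≤ 1 / δ) (ht : 0 ≤ t ∧ t ≤ s * e) :
    (1 - s / δ) / δ ≤ 1 + (1 - δ) * d - t ∧ 1 + (1 - δ) * d - t ≤ 1 / δ := by
  have hδ : 0 < δ := hs.trans hsd
  have h1 : δ * ((1 - s / δ) / δ) = 1 - s / δ := mul_div_cancel₀ _ hδ.ne'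
  have h2 : δ * (1 / δ) = 1 := mul_div_cancel₀ _ hδ.ne'
  have h3 : s * (1 / δ) = s / δ := by ring
  have h4 := mul_le_mul_of_nonneg_left he hs.le
  have h5 := mul_le_mul_of_nonneg_left hd.1 (sub_nonneg.2 hδ1.le)
  have h6 := mul_le_mul_of_nonneg_left hd.2 (sub_nonneg.2 hδ1.le)
  constructor <;> nlinarith

theorem shoot_sub_succ_bounds {δ s κ n A : ℝ} (hs : 0 < s) (hsd : s < δ) (hδ1 : δ < 1)
    (hA : κ ≤ s * A) : ∀ j, (1 - s / δ) / δ ≤ shoot δ s κ n A j - shoot δ s κ n A (j + 1) ∧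
      shoot δ s κ n A j - shoot δ s κ n A (j + 1) ≤ 1 / δ
  | 0 => by
    have := tail_slope_bounds hs hsd
    simpa [shoot] using this
  | 1 => by
    have := tail_slope_bounds hs hsd
    have hα : (δ + s) * (1 / (δ + s)) = 1 := mul_div_cancel₀ _ (by linarith)
    have hα0 : 0 < 1 / (δ + s) := by have := hs.trans hsd; positivity
    -- Since `κ ≤ s * A`, the positive part is active here, so the first backward step continues the
    -- affine tail with the same slope.
    have hm : max 0 (s * (A + 1 / (δ + s)) - κ) = s * (A + 1 / (δ + s)) - κ :=
      max_eq_right (by nlinarith)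
    have e : shoot δ s κ n A 1 - shoot δ s κ n A (1 + 1) = 1 / (δ + s) := by
      simp only [shoot, hm]
      push_cast
      linear_combination -hα
    rwa [e]
  | j + 2 => by
    have h0 := shoot_sub_succ_bounds (n := n) hs hsd hδ1 hA j
    have h1 := shoot_sub_succ_bounds (n := n) hs hsd hδ1 hA (j + 1)
    have hm : 0 < (1 - s / δ) / δ := by
      have hδ := hs.trans hsd
      have : s / δ < 1 := (div_lt_one hδ).2 hsd
      exact div_pos (by linarith) hδ
    have e : shoot δ s κ n A (j + 2) - shoot δ s κ n A (j + 2 + 1) =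
        1 + (1 - δ) * (shoot δ s κ n A (j + 1) - shoot δ s κ n A (j + 1 + 1)) -
        (max 0 (s * shoot δ s κ n A j - κ) - max 0 (s * shoot δ s κ n A (j + 1) - κ)) := by
      have a0 := shoot_add_two δ s κ n A j
      have a1 := shoot_add_two δ s κ n A (j + 1)
      push_cast at a1
      linear_combination a0 - a1
    rw [e]
    exact increment_bounds hs hsd hδ1 h1 h0.2
      (posPart_affine_sub_bounds hs.le (by linarith [h0.1]))

theorem shoot_bounds {δ s κ n A : ℝ} (hs : 0 < s) (hsd : s < δ) (hδ1 : δ < 1)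
    (hA : κ ≤ s * A) (j : ℕ) : A - j * (1 / δ) ≤ shoot δ s κ n A (j + 1) ∧
      shoot δ s κ n A (j + 1) ≤ A - j * ((1 - s / δ) / δ) := by
  induction j with
  | zero => simp [shoot]
  | succ j ih =>
    have := shoot_sub_succ_bounds (n := n) hs hsd hδ1 hA (j + 1)
    push_cast
    constructor <;> linarith

/-- The increment form of the optimality equation has a solution with increments bounded and
bounded away from zero. -/
theorem exists_relative_value {δ s κ : ℝ} (hs : 0 < s) (hsd : s < δ) (hδ1 : δ < 1) (hκ : 0 ≤ κ) :
    ∃ (X : ℕ → ℝ) (k : ℝ), X 2 = 0 ∧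
      (∀ v, X v = v - k + (1 - δ) * X (v + 1) - max 0 (s * X (v + 2) - κ)) ∧
      ∀ v, (1 - s / δ) / δ ≤ X (v + 1) - X v ∧ X (v + 1) - X v ≤ 1 / δ := by
  have hδ := hs.trans hsd
  have hm : 0 < (1 - s / δ) / δ := by
    have : s / δ < 1 := (div_lt_one hδ).2 hsd
    exact div_pos (by linarith) hδ
  -- `J` backward steps at the minimal slope descend from `κ / s` to a value `≤ 0`. At the other end
  -- of the range of `A`, even steps of maximal slope leave a value `≥ 0`, so some `A` gives exactly
  -- `0` at age `2`.
  obtain ⟨J, hJ⟩ := exists_nat_ge (κ / s / ((1 - s / δ) / δ))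
  rw [div_le_iff₀ hm] at hJ
  obtain ⟨A, hA, hA0⟩ : ∃ A ∈ Set.Icc (κ / s) (κ / s + J * (1 / δ)),
      shoot δ s κ ((J + 2 : ℕ) : ℝ) A (J + 1) = 0 := by
    have hκs : 0 ≤ κ / s := by positivity
    have hle : κ / s ≤ κ / s + J * (1 / δ) := le_add_of_nonneg_right (by positivity)
    have h1 : κ ≤ s * (κ / s) := (mul_div_cancel₀ _ hs.ne').ge
    apply intermediate_value_Icc hle (continuous_shoot δ s κ _ (J + 1)).continuousOn
    constructor
    · have := (shoot_bounds (n := ((J + 2 : ℕ) : ℝ)) hs hsd hδ1 h1 J).2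
      linarith
    · have := (shoot_bounds (n := ((J + 2 : ℕ) : ℝ)) hs hsd hδ1
        (h1.trans (mul_le_mul_of_nonneg_left hle hs.le)) J).1
      linarith
  have hA' : κ ≤ s * A := by
    have := hA.1
    rwa [div_le_iff₀' hs] at this
  have hα : (δ + s) * (1 / (δ + s)) = 1 := mul_div_cancel₀ _ (by linarith)
  have hα0 : 0 < 1 / (δ + s) := by positivity
  have hαb := tail_slope_bounds hs hsd
  set α := 1 / (δ + s) with hαdef
  set y := shoot δ s κ ((J + 2 : ℕ) : ℝ) A with hy
  -- With `n = J + 2`, shooting index `j` corresponds to age `n + 1 - j`; index `0` already lies on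
  -- the tail.
  set X : ℕ → ℝ := fun v => if v ≤ J + 2 then y (J + 3 - v) else A + α * (v - (J + 2)) with hX
  have htail : ∀ v, J + 2 ≤ v → X v = A + α * (v - (J + 2)) := by
    intro v hv
    rcases hv.eq_or_lt with rfl | hv
    · simp [hX, hy, shoot]
    · simp [hX, Nat.not_le.2 hv]
  have hhead : ∀ j, j ≤ J + 3 → X (J + 3 - j) = y j := by
    intro j hj
    rcases Nat.eq_zero_or_pos j with rfl | hj0
    · rw [htail _ (by omega)]
      simp [hy, shoot]
      ring
    · have h1 : J + 3 - j ≤ J + 2 := by omega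
      have h2 : J + 3 - (J + 3 - j) = j := by omega
      simp only [hX, if_pos h1, h2]
  refine ⟨X, ((J + 2 : ℕ) : ℝ) + κ - (δ + s) * A + (1 - δ - 2 * s) * α, ?_, ?_, ?_⟩
  · have := hhead (J + 1) (by omega)
    rw [show J + 3 - (J + 1) = 2 by omega] at this
    rw [this, hA0]
  · intro v
    rcases le_or_gt (J + 2) v with hv | hv
    · rw [htail v hv, htail (v + 1) (by omega), htail (v + 2) (by omega)]
      have hv' : ((J : ℝ) + 2) ≤ v := by exact_mod_cast hv
      have hmul : 0 ≤ s * (α * ((v : ℝ) + 2 - (J + 2))) :=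
        mul_nonneg hs.le (mul_nonneg hα0.le (by linarith))
      rw [max_eq_right (by push_cast; nlinarith)]
      push_cast
      linear_combination (v - (J + 2) : ℝ) * hα
    · obtain ⟨j, hj⟩ : ∃ j, v + j = J + 1 := ⟨J + 1 - v, by omega⟩
      have e0 := hhead (j + 2) (by omega)
      have e1 := hhead (j + 1) (by omega)
      have e2 := hhead j (by omega)
      rw [show J + 3 - (j + 2) = v by omega] at e0
      rw [show J + 3 - (j + 1) = v + 1 by omega] at e1
      rw [show J + 3 - j = v + 2 by omega] at e2
      have hv' : (v : ℝ) = J + 1 - j := by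
        have : (v : ℝ) + j = J + 1 := by exact_mod_cast hj
        linarith
      rw [e0, e1, e2, hy, shoot, hv']
      push_cast
      ring
  · intro v
    rcases le_or_gt (J + 2) v with hv | hv
    · rw [htail v hv, htail (v + 1) (by omega)]
      have e : A + α * (((v + 1 : ℕ) : ℝ) - (J + 2)) - (A + α * (v - (J + 2))) = α := by
        push_cast
        ring
      rwa [e]
    · have e0 := hhead (J + 2 - v + 1) (by omega)
      have e1 := hhead (J + 2 - v) (by omega)
      rw [show J + 3 - (J + 2 - v + 1) = v by omega] at e0
      rw [show J + 3 - (J + 2 - v) = v + 1 by omega] at e1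
      rw [e0, e1]
      exact shoot_sub_succ_bounds hs hsd hδ1 hA' _

/-! ### The relative value function and the optimality equation. -/

/-- The relative value function built from a solution `X` of its increment form. -/
noncomputable def relValue (q r c : ℝ) (X : ℕ → ℝ) : State → ℝ
  | (v, false, false) => X (v + 1)
  | (v, false, true) => q * X 2 + (1 - q) * X (v + 1)
  | (v, true, _) => q * X 1 + (1 - q) * X (v + 1) - max 0 (r * X (v + 2) - c)

section

variable {p q c g : ℝ} {X : ℕ → ℝ}

theorem stageCost_add_step_relValue_not_available
    (hrec : ∀ v : ℕ, X v = v - (g - p * q * X 1) + (1 - p * q) * X (v + 1) -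
      p * max 0 (q * (1 - q) * (1 - p) * X (v + 2) - c)) (v : ℕ+) (b a : Bool) :
    stageCost p q c (v, false, b) a +
      step p q a (v, false, b) (relValue q (q * (1 - q) * (1 - p)) c X) =
    g + relValue q (q * (1 - q) * (1 - p)) c X (v, false, b) + if a then c else 0 := by
  -- The recursion is needed at the two possible next ages: `v + 1` and, when a buffered packet is
  -- delivered, `2`.
  have h1 := hrec (v + 1)
  have h2 := hrec 2
  push_cast at h1 h2
  cases b <;> simp [stageCost, step, nextAge, relValue]
  · linear_combination -h1
  · linear_combination -(1 - q) * h1 - q * h2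

theorem stageCost_add_step_relValue_discard
    (hrec : ∀ v : ℕ, X v = v - (g - p * q * X 1) + (1 - p * q) * X (v + 1) -
      p * max 0 (q * (1 - q) * (1 - p) * X (v + 2) - c)) (v : ℕ+) (b : Bool) :
    stageCost p q c (v, true, b) false +
      step p q false (v, true, b) (relValue q (q * (1 - q) * (1 - p)) c X) =
    g + relValue q (q * (1 - q) * (1 - p)) c X (v, true, b) +
      max 0 (q * (1 - q) * (1 - p) * X (v + 2) - c) := by
  have h1 := hrec (v + 1)
  have h2 := hrec 1
  push_cast at h1 h2
  simp [stageCost, step, nextAge, relValue]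
  linear_combination -(1 - q) * h1 - q * h2

/-- Compared with discarding, storing costs `c` and saves `r * (X (v + 2) - X 2)`. After a success
the age is `1`, and delivering the buffered packet then gives `2`, the same as natural ageing, so
nothing is saved on that branch. -/
theorem stageCost_add_step_relValue_store (hX2 : X 2 = 0)
    (hrec : ∀ v : ℕ, X v = v - (g - p * q * X 1) + (1 - p * q) * X (v + 1) -
      p * max 0 (q * (1 - q) * (1 - p) * X (v + 2) - c)) (v : ℕ+) (b : Bool) :
    stageCost p q c (v, true, b) true +
      step p q true (v, true, b) (relValue q (q * (1 - q) * (1 - p)) c X) =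
    g + relValue q (q * (1 - q) * (1 - p)) c X (v, true, b) +
      max 0 (q * (1 - q) * (1 - p) * X (v + 2) - c) -
      (q * (1 - q) * (1 - p) * X (v + 2) - c) := by
  have h1 := hrec (v + 1)
  have h2 := hrec 1
  push_cast at h1 h2
  simp [stageCost, step, nextAge, relValue]
  linear_combination -(1 - q) * h1 - q * h2 + q * (1 - q) * (1 - p) * hX2

end

theorem step_add_const (p q : ℝ) (a : Action) (S : State) (F : State → ℝ) (D : ℝ) :
    step p q a S (fun S' => F S' + D) = step p q a S F + D := by
  simp only [step]
  ring

theorem relValue_bounds {q r c δ : ℝ} {X : ℕ → ℝ} (hq : 0 ≤ q) (hr : 0 ≤ r) (hrq : r ≤ 1 - q)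
    (hc : 0 ≤ c) (hδ : 0 < δ) (hX2 : X 2 = 0)
    (hinc : ∀ v, 0 ≤ X (v + 1) - X v ∧ X (v + 1) - X v ≤ 1 / δ) (S : State) :
    -(2 / δ) ≤ relValue q r c X S ∧ relValue q r c X S ≤ 1 / δ * ((S.1 : ℕ) : ℝ) := by
  obtain ⟨v, l, b⟩ := S
  have hd : 0 < 1 / δ := by positivity
  have h2d : 2 / δ = 2 * (1 / δ) := by ring
  have hup : ∀ n : ℕ, 0 ≤ X (n + 2) ∧ X (n + 2) ≤ 1 / δ * n := by
    intro n
    induction n with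
    | zero => simp [hX2]
    | succ n ih =>
      have := hinc (n + 2)
      rw [show n + 1 + 2 = n + 2 + 1 by ring]
      push_cast
      constructor <;> linarith
  obtain ⟨n, hn⟩ : ∃ n : ℕ, (v : ℕ) = n + 1 := ⟨v - 1, by have := v.pos; omega⟩
  have h1 := hup n
  have h2 := hinc (n + 2)
  have h3 := hinc 1
  norm_num [hX2] at h3
  have hcast : ((v : ℕ) : ℝ) = n + 1 := by exact_mod_cast hn
  have hq1 : 0 ≤ 1 - q := hr.trans hrq
  have e1 : X (v + 1) = X (n + 2) := by rw [hn]
  have e2 : X (v + 2) = X (n + 2 + 1) := by rw [hn]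
  rw [one_div] at *
  have hqX : 0 ≤ (1 - q) * X (n + 2) := mul_nonneg hq1 h1.1
  have hqX' : 0 ≤ q * X (n + 2) := mul_nonneg hq h1.1
  cases l
  · cases b
    · simp only [relValue, e1, hcast]
      constructor <;> linarith
    · simp only [relValue, e1, hcast, hX2]
      constructor <;> linarith
  · simp only [relValue, e1, e2, hcast]
    have h4 : 0 ≤ max 0 (r * X (n + 2 + 1) - c) := le_max_left _ _
    have h5 : q * X 1 ≤ 0 := mul_nonpos_of_nonneg_of_nonpos hq h3.1
    have h6 : -δ⁻¹ ≤ q * X 1 := by nlinarith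
    -- Because `r ≤ 1 - q`, the subtracted positive part exceeds `(1 - q) * X (v + 1)` by at most
    -- one increment of `X`.
    have h7 : max 0 (r * X (n + 2 + 1) - c) ≤ (1 - q) * X (n + 2) + δ⁻¹ := by
      refine max_le (by linarith) ?_
      have : r * X (n + 2 + 1) ≤ r * (X (n + 2) + δ⁻¹) :=
        mul_le_mul_of_nonneg_left (by linarith) hr
      nlinarith [mul_le_mul_of_nonneg_right hrq h1.1]
    constructor <;> linarith

end AgeStorage

/-! ### The threshold policy and its optimality. -/

open AgeStorage in
theorem lemma5 (p q : unitInterval) (hp0 : 0 < p) (hp1 : p < 1) (hq0 : 0 < q) (hq1 : q < 1)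
    (c : ℝ) (hc : 0 ≤ c) :
    ∃ f : AgeStorage.State → AgeStorage.Action,
      AgeStorage.IsSwitching f ∧ AgeStorage.IsAgeThreshold f ∧
      AgeStorage.StoresOnlyAvailable f ∧
      AgeStorage.IsOptimal p q c (AgeStorage.stationary f) := by
  have hp : (0 : ℝ) < p := hp0
  have hq : (0 : ℝ) < q := hq0
  have hp' : (0 : ℝ) < 1 - p := sub_pos.2 hp1
  have hq' : (0 : ℝ) < 1 - q := sub_pos.2 hq1
  set r : ℝ := q * (1 - q) * (1 - p) with hr
  have hr0 : 0 < r := by positivity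
  have hrq' : r ≤ 1 - q := by
    have : (q : ℝ) * (1 - p) ≤ 1 := by nlinarith
    nlinarith
  have hrq : r < q := by
    have : (1 - q : ℝ) * (1 - p) < 1 := by nlinarith
    nlinarith
  have hδ : (0 : ℝ) < p * q := by positivity
  have hs : 0 < p * r := by positivity
  have hsd : p * r < p * q := by nlinarith
  have hδ1 : (p * q : ℝ) < 1 := by nlinarith
  obtain ⟨X, k, hX2, hrec, hinc⟩ := exists_relative_value hs hsd hδ1 (mul_nonneg hp.le hc)
  have hm : 0 < (1 - p * r / (p * q)) / (p * q : ℝ) :=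
    div_pos (sub_pos.2 ((div_lt_one hδ).2 hsd)) hδ
  set g : ℝ := k + p * q * X 1 with hgdef
  have hrec' : ∀ v : ℕ, X v = v - (g - p * q * X 1) + (1 - p * q) * X (v + 1) -
      p * max 0 (r * X (v + 2) - c) := by
    intro v
    rw [mul_max_of_nonneg _ _ hp.le, mul_zero, mul_sub, ← mul_assoc, hgdef, add_sub_cancel_right]
    exact hrec v
  -- As `X 2 = 0`, the recursion at `1` gives `g = 1 - (1 - pq) * X 1 - max 0 (p * r * X 3 - p *
  -- c)`. This is the quantity bounded below by `increment_bounds`, hence positive.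
  have hg : 0 ≤ g := by
    have h1 := hrec 1
    have h4 : max 0 (p * r * X 2 - p * c) = 0 := by
      rw [hX2]
      exact max_eq_left (by nlinarith)
    have h5 := posPart_affine_sub_bounds (κ := p * c) hs.le
      (by linarith [(hinc 2).1] : X 2 ≤ X (2 + 1))
    have h6 := (increment_bounds hs hsd hδ1 (hinc 1) (hinc 2).2 h5).1
    rw [h4] at h6
    norm_num [hX2] at h1 h6
    nlinarith
  have hmono : Monotone X := monotone_nat_of_le_succ fun v => by linarith [(hinc v).1]
  have hthr : ∀ v v' : ℕ+, v ≤ v' → c ≤ r * X (v + 2) → c ≤ r * X (v' + 2) := fun v v' hv h =>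
    h.trans (mul_le_mul_of_nonneg_left
      (hmono (Nat.add_le_add_right (PNat.coe_le_coe _ _ |>.2 hv) 2)) hr0.le)
  classical
  refine ⟨fun S => S.2.1 && decide (c ≤ r * X (S.1 + 2)), ?_, ?_, ?_, ?_⟩
  · rintro ⟨v, l, b⟩ ⟨v', l', b'⟩ ⟨hv, hl, -⟩ h
    simp only [Bool.and_eq_true, decide_eq_true_eq] at h ⊢
    refine ⟨?_, hthr v v' hv h.2⟩
    have hl' : l ≤ l' := hl
    rw [h.1] at hl'
    exact top_le_iff.1 hl'
  · intro v v' b b' hv h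
    simp only [Bool.true_and, decide_eq_true_eq] at h ⊢
    exact hthr v v' hv h
  · intro v b
    rfl
  · have hb := relValue_bounds hq.le hr0.le hrq' hc hδ hX2
      fun v => ⟨hm.le.trans (hinc v).1, (hinc v).2⟩
    have hB : (0 : ℝ) < 1 / (p * q) := by positivity
    -- Adding `2 / (p * q)` makes the relative value nonnegative without affecting the equation;
    -- since ages are at least `1`, the growth constant becomes `1 + 2 = 3` times `1 / (p * q)`.
    refine isOptimal_of_optimality_equation p q hp0 hq0 hq1 hc _
      (fun S => relValue q r c X S + 2 / (p * q)) g (3 * (1 / (p * q))) hg (by positivity)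
      (fun S => by linarith [(hb S).1]) (fun S => ?_) (fun S a => ?_) fun S => ?_
    · have hv : (1 : ℝ) ≤ ((S.1 : ℕ) : ℝ) := by exact_mod_cast S.1.2
      have e : (2 / (p * q) : ℝ) = 2 * (1 / (p * q)) := by ring
      have := (hb S).2
      nlinarith
    · rw [step_add_const]
      obtain ⟨v, l, b⟩ := S
      cases l
      · have := stageCost_add_step_relValue_not_available hrec' v b a
        cases a <;> simp only [Bool.false_eq_true, if_false, if_true] at this <;> linarith
      · cases a
        · have := stageCost_add_step_relValue_discard hrec' v b
          linarith [le_max_left 0 (r * X (v + 2) - c)]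
        · have := stageCost_add_step_relValue_store hX2 hrec' v b
          linarith [le_max_right 0 (r * X (v + 2) - c)]
    · rw [step_add_const]
      obtain ⟨v, l, b⟩ := S
      cases l
      · have := stageCost_add_step_relValue_not_available hrec' v b false
        simp only [Bool.false_eq_true, if_false] at this
        simp only [Bool.false_and]
        linarith
      · by_cases h : c ≤ r * X (v + 2)
        · have := stageCost_add_step_relValue_store hX2 hrec' v b
          have hmax := max_eq_right (sub_nonneg.2 h)
          simp only [Bool.true_and, decide_eq_true h]
          linarith
        · have := stageCost_add_step_relValue_discard hrec' v b
          have hmax := max_eq_left (sub_nonpos.2 (not_le.1 h).le)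
          simp only [Bool.true_and, decide_eq_false h]
          linarith
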